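/- Let $(\Omega,\mathcal F,\mathbb P)$ be a nonatomic probability space, let $p\in[1,2]$, $q=(1-1/p)^{-1}\in[2,\infty]$, $m\in\mathbb R$ and $v>0$. Let $g:[0,\infty)\to\mathbb R$ be non-constant, increasing (in the non-strict sense) and $1$-Lipschitz with $g(0)=0$. Let $D:L^p\to[0,\infty)$ be a law-invariant deviation measure, that is, for all $X,Y\in L^p$: $D(X+c)=D(X)$ for $c\in\mathbb R$; $D(X)>0$ if $X$ is not a.s. constant; $D(\lambda X)=\lambda D(X)$ for $\lambda\ge 0$; $D(X+Y)\le D(X)+D(Y)$; and $D(X)=D(Y)$ if $X$ and $Y$ have the same distribution. Let $\Phi^p$ be the set of concave $h:[0,1]\to\mathbb R$ with $h(0)=h(1)=0$ and $\|h'\|_q<\infty$, where $h'$ is the left derivative, $\|\cdot\|_q$ is the Lebesgue $L^q$-norm on $(0,1)$, and $\|h'\|_q=\infty$ by convention if $h$ is not continuous on $[0,1]$. Suppose that $\Psi^p\subseteq\Phi^p$ is such that $$D(X)=\sup_{h\in\Psi^p}D_h(X)\quad\text{for all }X\in L^p,\qquad D_h(X)=\int_0^1\mathrm{VaR}_\alpha(X)\,h'(1-\alpha)\,\mathrm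 d\alpha,$$ where $\mathrm{VaR}_\alpha(X)=\inf\{x\in\mathbb R:\mathbb P(X\le x)\ge\alpha\}$. Put $\mathrm{MD}^D_g(X)=g(D(X))+\mathbb E[X]$. Then, as suprema in $[-\infty,\infty]$, $$\sup\left\{\mathrm{MD}^D_g(X): X\in L^2,\ \mathbb E[X]=m,\ \mathrm{Var}(X)=v^2\right\}=\sup_{h\in\Psi^p}g\left(v\,\|h'\|_2\right)+m .$$ -/

import Mathlib

open MeasureTheory ProbabilityTheory Set
open scoped ENNReal NNReal

noncomputable section

namespace MeanDeviation

variable {Ω : Type*} [MeasurableSpace Ω]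

/-- A measure without atoms: every measurable set of positive measure has a measurable subset of
strictly smaller positive measure. (Mathlib's `NoAtoms` only says that points are null.) -/
def IsNonatomic (P : Measure Ω) : Prop :=
  ∀ A : Set Ω, MeasurableSet A → 0 < P A →
    ∃ B : Set Ω, MeasurableSet B ∧ B ⊆ A ∧ 0 < P B ∧ P B < P A

/-- The left `α`-quantile `VaR_α(X) = inf {x ∈ ℝ : P(X ≤ x) ≥ α}`, for `α ∈ (0,1)`. -/
def VaR (P : Measure Ω) (X : Ω → ℝ) (α : ℝ) : ℝ :=
  sInf {x : ℝ | α ≤ P.real {ω | X ω ≤ x}}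

/-- The set `𝒟ᵖ` of law-invariant deviation measures `D : Lᵖ → [0,∞)`. Elements of `Lᵖ` are
represented by functions `X` with `MemLp X p P`; the values of `D` at other functions are irrelevant.
By law invariance, `D` does not distinguish functions that agree almost surely. -/
structure IsLawInvariantDeviation (P : Measure Ω) (p : ℝ≥0∞) (D : (Ω → ℝ) → ℝ) : Prop where
  nonneg : ∀ X, MemLp X p P → 0 ≤ D X
  translation : ∀ X, MemLp X p P → ∀ c : ℝ, D (fun ω => X ω + c) = D X
  pos : ∀ X, MemLp X p P → (¬ ∃ c : ℝ, X =ᵐ[P] fun _ => c) → 0 < D X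
  pos_homogeneous : ∀ X, MemLp X p P → ∀ c : ℝ, 0 ≤ c → D (fun ω => c * X ω) = c * D X
  subadditive : ∀ X Y, MemLp X p P → MemLp Y p P → D (fun ω => X ω + Y ω) ≤ D X + D Y
  law_invariant : ∀ X Y, MemLp X p P → MemLp Y p P → IdentDistrib X Y P P → D X = D Y

/-- The set `𝒢` of risk-weighting functions `g : [0,∞) → ℝ`: non-constant, increasing,
1-Lipschitz, with `g 0 = 0`. Only the values of `g` on `[0,∞)` matter. -/
structure IsRiskWeighting (g : ℝ → ℝ) : Prop where
  nonconstant : ∃ x ∈ Ici (0 : ℝ), ∃ y ∈ Ici (0 : ℝ), g x ≠ g y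
  mono : MonotoneOn g (Ici 0)
  lipschitz : ∀ x ∈ Ici (0 : ℝ), ∀ y ∈ Ici (0 : ℝ), |g x - g y| ≤ |x - y|
  zero : g 0 = 0

/-- The set `ℋ` of concave functions `h : [0,1] → ℝ` with `h 0 = h 1 = 0`. Only the values of `h`
on `[0,1]` matter. -/
def DistortionFunctions : Set (ℝ → ℝ) :=
  {h | ConcaveOn ℝ (Icc 0 1) h ∧ h 0 = 0 ∧ h 1 = 0}

/-- The left derivative `h'`, used at points of `(0,1)`, where it exists for concave `h`. -/
def leftDeriv (h : ℝ → ℝ) (t : ℝ) : ℝ :=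
  derivWithin h (Iio t) t

open Classical in
/-- The norm `‖h'‖_q` over `(0,1)`, with `‖h'‖_q = ∞` if `h` is not continuous on `[0,1]`.
For `q = ∞` the essential supremum is the supremum, since `h'` is left-continuous on `(0,1)`. -/
def derivNorm (h : ℝ → ℝ) (q : ℝ≥0∞) : ℝ≥0∞ :=
  if ContinuousOn h (Icc 0 1) then eLpNorm (leftDeriv h) q (volume.restrict (Ioo (0 : ℝ) 1)) else ∞

/-- `Φᵖ = {h ∈ ℋ : ‖h'‖_q < ∞}` with `q = (1 - 1/p)⁻¹` (so `q = ∞` for `p = 1`). -/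
def Phi (p : ℝ≥0∞) : Set (ℝ → ℝ) :=
  {h | h ∈ DistortionFunctions ∧ derivNorm h (1 - 1 / p)⁻¹ < ∞}

/-- The signed Choquet integral `D_h(X) = ∫₀¹ VaR_α(X) h'(1 - α) dα`. -/
def signedChoquet (P : Measure Ω) (h : ℝ → ℝ) (X : Ω → ℝ) : ℝ :=
  ∫ α in Ioo (0 : ℝ) 1, VaR P X α * leftDeriv h (1 - α)

/-- `D(X) = sup_{h ∈ Ψ} D_h(X)` for all `X ∈ Lᵖ`, the supremum being a genuine one in `ℝ`. -/
def IsSupOfChoquet (P : Measure Ω) (p : ℝ≥0∞) (Ψ : Set (ℝ → ℝ)) (D : (Ω → ℝ) → ℝ) : Prop :=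
  ∀ X, MemLp X p P → IsLUB ((fun h => signedChoquet P h X) '' Ψ) (D X)

/-- The mean-deviation measure `MD_g^D(X) = g(D(X)) + E[X]`. -/
def MD (P : Measure Ω) (g : ℝ → ℝ) (D : (Ω → ℝ) → ℝ) (X : Ω → ℝ) : ℝ :=
  g (D X) + ∫ ω, X ω ∂P

/-- `L²(m,v)`: square-integrable random variables with mean `m` and variance `v²`. -/
def L2MeanVar (P : Measure Ω) (m v : ℝ) : Set (Ω → ℝ) :=
  {X | MemLp X 2 P ∧ ∫ ω, X ω ∂P = m ∧ variance X P = v ^ 2}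

/-- The worst-case value `sup {MD_g^D(X) : X ∈ L²(m,v)}`, as a supremum in `[-∞,∞]`. -/
def worstCaseMD (P : Measure Ω) (g : ℝ → ℝ) (D : (Ω → ℝ) → ℝ) (m v : ℝ) : EReal :=
  ⨆ X ∈ L2MeanVar P m v, (MD P g D X : EReal)

end MeanDeviation

end

/-!
Fix `h ∈ Φᵖ` and put `f α = h' (1 - α)` on `(0,1)`. Since `q ≥ 2`, `f` is square-integrable, and
since `h` is continuous with `h 0 = h 1 = 0`, `f` has mean zero under the uniform distribution; its
standard deviation is `‖h'‖₂`. The quantile function of `X` has, under the uniform distribution, the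
law of `X`, so `D_h(X)` is the covariance of `f` with a function of standard deviation `v`, and the
Cauchy–Schwarz inequality gives `D_h(X) ≤ v ‖h'‖₂` on `L²(m,v)` (`signedChoquet_le`).

Concavity of `h` makes `f` increasing. A nonatomic space carries a uniform variable `U`
(`IsNonatomic.exists_uniform`), and for increasing `f` the quantile function of `m + (v / ‖h'‖₂) f(U)`
is almost everywhere `m + (v / ‖h'‖₂) f`, which is the case of equality in Cauchy–Schwarz
(`IsNonatomic.exists_signedChoquet_eq`).

The theorem follows by taking suprema over `h ∈ Ψ`: `g` is increasing, which gives `≥`, and it is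
1-Lipschitz, which lets it pass through the supremum defining `D(X)` even if that is not attained.
-/

namespace MeanDeviation

open Filter Topology

/-! ### Quantiles -/

/-- Lebesgue measure on `(0,1)`, the uniform distribution. -/
noncomputable abbrev uniform01 : Measure ℝ := volume.restrict (Ioo (0 : ℝ) 1)

instance isProbabilityMeasure_uniform01 : IsProbabilityMeasure uniform01 :=
  ⟨by simp [uniform01]⟩

theorem uniform01_Iio (a : ℝ) : uniform01 (Iio a) = ENNReal.ofReal (min a 1) := by
  have : Iio a ∩ Ioo (0 : ℝ) 1 = Ioo 0 (min a 1) := by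
    ext y; simp only [mem_inter_iff, mem_Iio, mem_Ioo, lt_min_iff]; tauto
  rw [uniform01, Measure.restrict_apply measurableSet_Iio, this, Real.volume_Ioo, sub_zero]

variable {Ω : Type*} [MeasurableSpace Ω] {P : Measure Ω}

/-- The Galois connection between the left quantile and the distribution function. -/
theorem VaR_le_iff [IsProbabilityMeasure P] {X : Ω → ℝ} (hX : AEMeasurable X P) {α : ℝ}
    (hα : α ∈ Ioo (0 : ℝ) 1) (x : ℝ) :
    VaR P X α ≤ x ↔ α ≤ P.real {ω | X ω ≤ x} := by
  have := Measure.isProbabilityMeasure_map hX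
  have hF : ∀ y, P.real {ω | X ω ≤ y} = cdf (P.map X) y := fun y => by
    rw [cdf_eq_real, measureReal_def, measureReal_def,
      Measure.map_apply_of_aemeasurable hX measurableSet_Iic]
    rfl
  simp only [VaR, hF]
  set S := {y : ℝ | α ≤ cdf (P.map X) y}
  obtain ⟨u, hu⟩ := ((tendsto_cdf_atTop (P.map X)).eventually (eventually_ge_nhds hα.2)).exists
  obtain ⟨l, hl⟩ := ((tendsto_cdf_atBot (P.map X)).eventually_lt_const hα.1).exists
  have hne : S.Nonempty := ⟨u, hu⟩
  have hbdd : BddBelow S := ⟨l, fun y hy => by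
    by_contra! h
    exact absurd hy (not_le.2 ((monotone_cdf _ h.le).trans_lt hl))⟩
  refine ⟨fun h => ?_, fun h => csInf_le hbdd h⟩
  -- right-continuity of the distribution function puts the infimum in the set
  have hright : Tendsto (cdf (P.map X)) (𝓝[>] x) (𝓝 (cdf (P.map X) x)) :=
    ((cdf (P.map X)).right_continuous x).mono_left (nhdsWithin_mono _ Ioi_subset_Ici_self)
  refine ge_of_tendsto hright ?_
  filter_upwards [self_mem_nhdsWithin] with y hy
  obtain ⟨z, hz, hzy⟩ := exists_lt_of_csInf_lt hne (h.trans_lt hy)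
  exact le_trans hz (monotone_cdf _ hzy.le)

theorem monotoneOn_VaR [IsProbabilityMeasure P] {X : Ω → ℝ} (hX : AEMeasurable X P) :
    MonotoneOn (VaR P X) (Ioo 0 1) := fun _ ha _ hb hab =>
  (VaR_le_iff hX ha _).2 (hab.trans ((VaR_le_iff hX hb _).1 le_rfl))

/-- The quantile function, under the uniform distribution, has the law of the random variable. -/
theorem identDistrib_VaR [IsProbabilityMeasure P] {X : Ω → ℝ} (hX : AEMeasurable X P) :
    IdentDistrib (VaR P X) X uniform01 P := by
  have hV : AEMeasurable (VaR P X) uniform01 :=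
    aemeasurable_restrict_of_monotoneOn measurableSet_Ioo (monotoneOn_VaR hX)
  refine ⟨hV, hX, ?_⟩
  have := Measure.isProbabilityMeasure_map hV
  refine Measure.ext_of_Iic _ _ fun x => ?_
  rw [Measure.map_apply_of_aemeasurable hV measurableSet_Iic,
    Measure.map_apply_of_aemeasurable hX measurableSet_Iic,
    Measure.restrict_apply' measurableSet_Ioo]
  have h1 : P.real {ω | X ω ≤ x} ≤ 1 := measureReal_le_one
  have hP : P (X ⁻¹' Iic x) = ENNReal.ofReal (P.real {ω | X ω ≤ x}) :=
    (ofReal_measureReal).symm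
  rw [hP]
  refine le_antisymm ?_ ?_
  · calc _ ≤ volume (Ioc 0 (P.real {ω | X ω ≤ x})) :=
          measure_mono fun α hα => ⟨hα.2.1, (VaR_le_iff hX hα.2 x).1 hα.1⟩
      _ = _ := by rw [Real.volume_Ioc, sub_zero]
  · calc _ = volume (Ioo 0 (P.real {ω | X ω ≤ x})) := by rw [Real.volume_Ioo, sub_zero]
      _ ≤ _ := measure_mono fun α hα => by
          have hα' : α ∈ Ioo (0 : ℝ) 1 := ⟨hα.1, hα.2.trans_le h1⟩
          exact ⟨(VaR_le_iff hX hα' x).2 hα.2.le, hα'⟩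

/-- If `U` is uniform and `f` is increasing, then `f` is a version of the quantile function of
`f ∘ U`: it dominates that function pointwise, and both have the same integral. -/
theorem VaR_comp_ae_eq [IsProbabilityMeasure P] {U : Ω → ℝ} (hU : AEMeasurable U P)
    (hlaw : P.map U = uniform01)
    {f : ℝ → ℝ} (hf : MonotoneOn f (Ioo 0 1)) (hfi : Integrable f uniform01) :
    IdentDistrib (fun ω => f (U ω)) f P uniform01 ∧
      VaR P (fun ω => f (U ω)) =ᵐ[uniform01] f := by
  have hid : IdentDistrib (fun ω => f (U ω)) f P uniform01 := by
    have h : IdentDistrib U id P uniform01 := ⟨hU, aemeasurable_id, by rw [hlaw, Measure.map_id]⟩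
    exact h.comp_of_aemeasurable (u := f) (by rw [hlaw]; exact hfi.aemeasurable)
  have hX := hid.aemeasurable_fst
  have hVf : IdentDistrib (VaR P fun ω => f (U ω)) f uniform01 uniform01 :=
    (identDistrib_VaR hX).trans hid
  refine ⟨hid, ?_⟩
  have hle : VaR P (fun ω => f (U ω)) ≤ᵐ[uniform01] f := by
    filter_upwards [ae_restrict_mem measurableSet_Ioo] with α hα
    rw [VaR_le_iff hX hα]
    have h1 : uniform01.real (Ioc 0 α) = α := by
      have : Ioc 0 α ∩ Ioo 0 1 = Ioc 0 α :=
        inter_eq_left.2 fun y hy => ⟨hy.1, hy.2.trans_lt hα.2⟩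
      rw [measureReal_def, Measure.restrict_apply measurableSet_Ioc, this, Real.volume_Ioc,
        sub_zero, ENNReal.toReal_ofReal hα.1.le]
    have h2 : P.real (U ⁻¹' Ioc 0 α) = α := by
      rw [← hlaw, measureReal_def, Measure.map_apply_of_aemeasurable hU measurableSet_Ioc] at h1
      exact h1
    calc α = P.real (U ⁻¹' Ioc 0 α) := h2.symm
      _ ≤ _ := measureReal_mono fun ω hω => hf ⟨hω.1, lt_of_le_of_lt hω.2 hα.2⟩ hα hω.2
  have hVi : Integrable (VaR P fun ω => f (U ω)) uniform01 := hVf.symm.integrable_snd hfi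
  exact ((integral_eq_iff_of_ae_le hVi hfi hle).1 hVf.integral_eq)

/-! ### Uniform random variables on nonatomic spaces -/

/-- A nonatomic probability space carries an almost surely increasing family of events with
prescribed probabilities: a maximal chain for almost sure inclusion takes every probability. -/
theorem IsNonatomic.exists_chain [IsProbabilityMeasure P] (hP : IsNonatomic P) :
    ∃ A : ℝ → Set Ω, (∀ x ∈ Icc (0 : ℝ) 1, MeasurableSet (A x) ∧ P.real (A x) = x) ∧
      ∀ x ∈ Icc (0 : ℝ) 1, ∀ y ∈ Icc (0 : ℝ) 1, x ≤ y → A x ≤ᵐ[P] A y := by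
  let r : {A : Set Ω // MeasurableSet A} → {A : Set Ω // MeasurableSet A} → Prop :=
    fun A B => A.1 ≤ᵐ[P] B.1
  set C := maxChain r
  have hC : IsMaxChain r C := maxChain_spec
  -- maximality: an event comparable with the whole chain belongs to it
  have hmem : ∀ A, (∀ B ∈ C, r A B ∨ r B A) → A ∈ C := fun A hA => by
    rw [hC.2 (hC.1.insert fun B hB _ => hA B hB) (subset_insert _ _)]
    exact mem_insert _ _
  have htot : ∀ A ∈ C, ∀ B ∈ C, r A B ∨ r B A := fun A hA B hB => by
    rcases eq_or_ne A B with rfl | h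
    · exact Or.inl EventuallyLE.rfl
    · exact hC.1 hA hB h
  have hmono : ∀ A ∈ C, ∀ B ∈ C, P A.1 ≤ P B.1 → r A B := fun A hA B hB h => by
    rcases htot A hA B hB with h' | h'
    · exact h'
    · exact (ae_eq_of_ae_subset_of_measure_ge h' h B.2.nullMeasurableSet (measure_ne_top _ _)).symm.le
  have hempty : (⟨∅, MeasurableSet.empty⟩ : {A : Set Ω // MeasurableSet A}) ∈ C :=
    hmem _ fun B _ => Or.inl (LE.le.eventuallyLE (empty_subset _))
  have huniv : (⟨univ, MeasurableSet.univ⟩ : {A : Set Ω // MeasurableSet A}) ∈ C :=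
    hmem _ fun B _ => Or.inr (LE.le.eventuallyLE (subset_univ _))
  -- the probabilities taken on the chain form a closed set: countable unions and intersections of
  -- members are members
  have hsup : ∀ x : ℝ≥0∞, ∃ L ∈ C, P L.1 ≤ x ∧ ∀ A ∈ C, P A.1 ≤ x → P A.1 ≤ P L.1 := by
    intro x
    set s := {A | A ∈ C ∧ P A.1 ≤ x}
    have hne : ((fun A => P A.1) '' s).Nonempty := ⟨_, _, ⟨hempty, by simp⟩, rfl⟩
    obtain ⟨u, humono, hulim, hu⟩ := exists_seq_tendsto_sSup hne (OrderTop.bddAbove _)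
    choose A hA hAu using hu
    simp only at hAu
    have hstep : ∀ i j, i ≤ j → r (A i) (A j) := fun i j hij =>
      hmono _ (hA i).1 _ (hA j).1 (by rw [hAu, hAu]; exact humono hij)
    have hPL : P (⋃ n, (A n).1) = ⨆ n, P (A n).1 := by
      rw [measure_iUnion_eq_iSup_accumulate]
      refine iSup_congr fun n => le_antisymm (measure_mono_ae ?_)
        (measure_mono (subset_accumulate (s := fun n => (A n).1)))
      rw [ae_le_set, accumulate_def, iUnion_sdiff, measure_iUnion_null_iff]
      intro i
      rw [iUnion_sdiff, measure_iUnion_null_iff]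
      exact fun hi => ae_le_set.1 (hstep i n hi)
    refine ⟨⟨⋃ n, (A n).1, MeasurableSet.iUnion fun n => (A n).2⟩, hmem _ fun B hB => ?_, ?_, ?_⟩
    · by_cases h : ∀ n, r (A n) B
      · left
        exact ae_le_set.2 (by
          rw [iUnion_sdiff, measure_iUnion_null_iff]
          exact fun i => ae_le_set.1 (h i))
      · push Not at h
        obtain ⟨n, hn⟩ := h
        right
        exact ((htot _ (hA n).1 B hB).resolve_left hn).trans
          (LE.le.eventuallyLE (subset_iUnion (fun n => (A n).1) n))
    · exact hPL.trans_le (iSup_le fun n => (hA n).2)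
    · intro B hB hBx
      refine (le_sSup
        (show P B.1 ∈ (fun A => P A.1) '' s from ⟨B, ⟨hB, hBx⟩, rfl⟩)).trans ?_
      refine le_of_tendsto hulim (Eventually.of_forall fun n => ?_)
      rw [← hAu]
      exact measure_mono (subset_iUnion (fun n => (A n).1) n)
  have hinf : ∀ x : ℝ≥0∞, x ≤ 1 →
      ∃ R ∈ C, x ≤ P R.1 ∧ ∀ A ∈ C, x ≤ P A.1 → P R.1 ≤ P A.1 := by
    intro x hx
    set s := {A | A ∈ C ∧ x ≤ P A.1}
    have hne : ((fun A => P A.1) '' s).Nonempty := ⟨_, _, ⟨huniv, by simpa using hx⟩, rfl⟩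
    obtain ⟨u, humono, hulim, hu⟩ := exists_seq_tendsto_sInf hne (OrderBot.bddBelow _)
    choose A hA hAu using hu
    simp only at hAu
    have hstep : ∀ i j, i ≤ j → r (A j) (A i) := fun i j hij =>
      hmono _ (hA j).1 _ (hA i).1 (by rw [hAu, hAu]; exact humono hij)
    have hPR : P (⋂ n, (A n).1) = ⨅ n, P (A n).1 := by
      rw [measure_iInter_eq_iInf_measure_iInter_le (fun n => (A n).2.nullMeasurableSet)
        ⟨0, measure_ne_top _ _⟩]
      refine iInf_congr fun n => le_antisymm
        (measure_mono (iInter₂_subset (s := fun i _ => (A i).1) n le_rfl))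
        (measure_mono_ae ?_)
      exact ae_le_set.2 (by
        rw [sdiff_iInter, measure_iUnion_null_iff]
        intro i
        rw [sdiff_iInter, measure_iUnion_null_iff]
        exact fun hi => ae_le_set.1 (hstep i n hi))
    refine ⟨⟨⋂ n, (A n).1, MeasurableSet.iInter fun n => (A n).2⟩, hmem _ fun B hB => ?_, ?_, ?_⟩
    · by_cases h : ∀ n, r B (A n)
      · right
        exact ae_le_set.2 (by
          rw [sdiff_iInter, measure_iUnion_null_iff]
          exact fun i => ae_le_set.1 (h i))
      · push Not at h
        obtain ⟨n, hn⟩ := h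
        left
        exact (LE.le.eventuallyLE (iInter_subset (fun n => (A n).1) n)).trans
          ((htot _ (hA n).1 B hB).resolve_right hn)
    · exact (le_iInf fun n => (hA n).2).trans_eq hPR.symm
    · intro B hB hBx
      refine le_trans ?_ (sInf_le
        (show P B.1 ∈ (fun A => P A.1) '' s from ⟨B, ⟨hB, hBx⟩, rfl⟩))
      refine ge_of_tendsto hulim (Eventually.of_forall fun n => ?_)
      rw [← hAu]
      exact measure_mono (iInter_subset (fun n => (A n).1) n)
  have hlevel : ∀ x : ℝ≥0∞, x ≤ 1 → ∃ A ∈ C, P A.1 = x := by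
    intro x hx
    obtain ⟨L, hL, hLx, hLmax⟩ := hsup x
    obtain ⟨R, hR, hRx, hRmin⟩ := hinf x hx
    by_contra! hno
    have hlt : P L.1 < P R.1 := (lt_of_le_of_ne hLx (hno L hL)).trans_le hRx
    have hdiff : 0 < P (R.1 \ L.1) := by
      refine pos_iff_ne_zero.2 fun h => hlt.not_ge (measure_mono_ae (ae_le_set.2 h))
    -- a proper part of the gap can be inserted into the chain, against maximality
    obtain ⟨B, hBm, hBs, hB0, hB1⟩ := hP _ (R.2.diff L.2) hdiff
    have hLR : r L R := hmono L hL R hR hlt.le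
    have hK : (⟨L.1 ∪ B, L.2.union hBm⟩ : {A : Set Ω // MeasurableSet A}) ∈ C := by
      refine hmem _ fun A hA => ?_
      rcases le_total (P A.1) x with h | h
      · right
        exact (hmono A hA L hL (hLmax A hA h)).trans
          (LE.le.eventuallyLE subset_union_left)
      · left
        refine EventuallyLE.trans ?_ (hmono R hR A hA (hRmin A hA h))
        exact ae_le_set.2 (by
          rw [union_sdiff_distrib, measure_union_null_iff]
          exact ⟨ae_le_set.1 hLR, by rw [sdiff_eq_empty.2 (hBs.trans sdiff_subset), measure_empty]⟩)
    have hdisj : Disjoint L.1 B := disjoint_sdiff_right.mono_right hBs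
    have hPK : P (L.1 ∪ B) = P L.1 + P B := measure_union hdisj hBm
    have hgt : P L.1 < P (L.1 ∪ B) := by
      rw [hPK]; exact ENNReal.lt_add_right (measure_ne_top _ _) hB0.ne'
    have hltR : P (L.1 ∪ B) < P R.1 := by
      rw [hPK]
      calc P L.1 + P B < P L.1 + P (R.1 \ L.1) :=
            (ENNReal.add_lt_add_iff_left (measure_ne_top _ _)).2 hB1
        _ = P (L.1 ∪ R.1) := by
            rw [← measure_union disjoint_sdiff_right (R.2.diff L.2), union_sdiff_self]
        _ = P R.1 := measure_congr (union_ae_eq_right_iff_ae_subset.2 hLR)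
    rcases le_total (P (L.1 ∪ B)) x with h | h
    · exact (hLmax _ hK h).not_gt hgt
    · exact (hRmin _ hK h).not_gt hltR
  have hsel : ∀ x : ℝ, ∃ A, x ∈ Icc (0 : ℝ) 1 → A ∈ C ∧ P A.1 = ENNReal.ofReal x := fun x => by
    by_cases hx : x ∈ Icc (0 : ℝ) 1
    · obtain ⟨A, hA, h⟩ := hlevel (ENNReal.ofReal x) (by simpa using hx.2)
      exact ⟨A, fun _ => ⟨hA, h⟩⟩
    · exact ⟨⟨∅, MeasurableSet.empty⟩, fun h => absurd h hx⟩
  choose A hA using hsel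
  refine ⟨fun x => (A x).1, fun x hx => ⟨(A x).2, ?_⟩, fun x hx y hy hxy => ?_⟩
  · rw [measureReal_def, (hA x hx).2, ENNReal.toReal_ofReal hx.1]
  · refine hmono _ (hA x hx).1 _ (hA y hy).1 ?_
    rw [(hA x hx).2, (hA y hy).2]
    exact ENNReal.ofReal_le_ofReal hxy

/-- With events `A q` of probability `q` increasing almost surely in the rational `q`, the variable
`ω ↦ inf {q | ω ∈ A q}` is uniform. -/
theorem IsNonatomic.exists_uniform [IsProbabilityMeasure P] (hP : IsNonatomic P) :
    ∃ U : Ω → ℝ, Measurable U ∧ P.map U = uniform01 := by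
  classical
  obtain ⟨A, hA, hmono⟩ := hP.exists_chain
  let I := {q : ℚ // (q : ℝ) ∈ Icc (0 : ℝ) 1}
  -- the value `1` off `A q` leaves the infimum over `{q | ω ∈ A q}` unchanged and makes it `1` if
  -- there is no such `q`
  let u : I → Ω → ℝ := fun q => (A q.1).piecewise (fun _ => (q.1 : ℝ)) fun _ => 1
  let U : Ω → ℝ := fun ω => ⨅ q, u q ω
  have : Nonempty I := ⟨⟨0, by simp⟩⟩
  have hu0 : ∀ q ω, 0 ≤ u q ω := fun q ω => by
    by_cases h : ω ∈ A q.1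
    · simpa [u, h] using q.2.1
    · simp [u, h]
  have hbdd : ∀ ω, BddBelow (range fun q => u q ω) := fun ω =>
    ⟨0, by rintro _ ⟨q, rfl⟩; exact hu0 q ω⟩
  have hUm : Measurable U := Measurable.iInf fun q =>
    Measurable.piecewise (hA _ q.2).1 measurable_const measurable_const
  have hU0 : ∀ ω, 0 ≤ U ω := fun ω => le_ciInf fun q => hu0 q ω
  have hmem : ∀ q : I, ∀ ω ∈ A q.1, U ω ≤ q.1 := fun q ω h =>
    (ciInf_le (hbdd ω) q).trans_eq (by simp [u, h])
  refine ⟨U, hUm, ?_⟩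
  have := Measure.isProbabilityMeasure_map hUm.aemeasurable (μ := P)
  have hreal : ∀ a : ℝ, P.real (U ⁻¹' Iio a) = max (min a 1) 0 := by
    intro a
    refine le_antisymm ?_ ?_
    · rcases lt_or_ge 1 a with h | h
      · rw [min_eq_right h.le, max_eq_left zero_le_one]; exact measureReal_le_one
      rcases lt_or_ge a 0 with h0 | h0
      · have : U ⁻¹' Iio a = ∅ := eq_empty_of_forall_notMem fun ω hω =>
          (hU0 ω).not_gt (lt_trans hω h0)
        rw [this, measureReal_empty]; exact le_max_right _ _
      rw [min_eq_left h, max_eq_left h0]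
      conv_rhs => rw [← (hA a ⟨h0, h⟩).2]
      have hsub : U ⁻¹' Iio a ⊆ ⋃ q : {q : I // (q.1 : ℝ) ≤ a}, A q.1.1 := fun ω hω => by
        obtain ⟨q, hq⟩ := exists_lt_of_ciInf_lt (show ⨅ q, u q ω < a from hω)
        by_cases hωq : ω ∈ A q.1
        · exact mem_iUnion.2 ⟨⟨q, by simpa [u, hωq] using hq.le⟩, hωq⟩
        · simp only [u, piecewise_eq_of_notMem _ _ _ hωq] at hq
          exact absurd hq h.not_gt
      refine ENNReal.toReal_mono (measure_ne_top _ _) (measure_mono_ae ?_)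
      refine (LE.le.eventuallyLE hsub).trans (ae_le_set.2 ?_)
      rw [iUnion_sdiff, measure_iUnion_null_iff]
      exact fun q => ae_le_set.1 (hmono _ q.1.2 _ ⟨h0, h⟩ q.2)
    · refine max_le (le_of_forall_lt fun y hy => ?_) measureReal_nonneg
      rcases lt_or_ge y 0 with h0 | h0
      · exact h0.trans_le measureReal_nonneg
      obtain ⟨q, hyq, hq⟩ := exists_rat_btwn hy
      have hqI : (q : ℝ) ∈ Icc (0 : ℝ) 1 := ⟨h0.trans hyq.le, hq.le.trans (min_le_right _ _)⟩
      refine hyq.trans_le ?_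
      rw [← (hA q hqI).2]
      exact measureReal_mono fun ω hω =>
        (hmem ⟨q, hqI⟩ ω hω).trans_lt (hq.trans_le (min_le_left _ _))
  refine Measure.ext_of_Ici _ _ fun a => ?_
  rw [← compl_Iio, prob_compl_eq_one_sub measurableSet_Iio, prob_compl_eq_one_sub measurableSet_Iio,
    uniform01_Iio, Measure.map_apply hUm measurableSet_Iio, ← ofReal_measureReal, hreal,
    ENNReal.ofReal_max, ENNReal.ofReal_zero, max_eq_left zero_le]

variable [IsProbabilityMeasure P]

/-! ### Derivatives of distortion functions -/

theorem DistortionFunctions.hasDerivWithinAt_leftDeriv {h : ℝ → ℝ} (hh : h ∈ DistortionFunctions)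
    {t : ℝ} (ht : t ∈ Ioo (0 : ℝ) 1) : HasDerivWithinAt h (leftDeriv h t) (Iio t) t := by
  have := hh.1.neg.hasDerivWithinAt_leftDeriv_of_mem_interior (by rwa [interior_Icc])
  have h2 := this.neg
  rw [neg_neg] at h2
  exact h2.differentiableWithinAt.hasDerivWithinAt

theorem DistortionFunctions.antitoneOn_leftDeriv {h : ℝ → ℝ} (hh : h ∈ DistortionFunctions) :
    AntitoneOn (leftDeriv h) (Ioo 0 1) := fun s hs t ht hst => by
  have := hh.1.neg.monotoneOn_leftDeriv (by rwa [interior_Icc]) (by rwa [interior_Icc]) hst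
  simpa [leftDeriv, derivWithin.neg] using this

theorem DistortionFunctions.monotoneOn_leftDeriv_one_sub {h : ℝ → ℝ}
    (hh : h ∈ DistortionFunctions) : MonotoneOn (fun α => leftDeriv h (1 - α)) (Ioo 0 1) :=
  fun s hs t ht hst => antitoneOn_leftDeriv hh ⟨by linarith [ht.2], by linarith [ht.1]⟩
    ⟨by linarith [hs.2], by linarith [hs.1]⟩ (by linarith)

theorem measurePreserving_one_sub :
    MeasurePreserving (fun α : ℝ => 1 - α) uniform01 uniform01 := by
  have := (Measure.measurePreserving_sub_left (volume : Measure ℝ) 1).restrict_preimage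
    (measurableSet_Ioo (a := (0 : ℝ)) (b := 1))
  simpa using this

/-- A continuous distortion function with integrable derivative is the integral of its left
derivative, so that derivative has mean `h 1 - h 0 = 0`. -/
theorem DistortionFunctions.integral_leftDeriv_one_sub {h : ℝ → ℝ} (hh : h ∈ DistortionFunctions)
    (hc : ContinuousOn h (Icc 0 1))
    (hi : Integrable (fun α => leftDeriv h (1 - α)) uniform01) :
    ∫ α, leftDeriv h (1 - α) ∂uniform01 = 0 := by
  have hmaps : MapsTo (fun α : ℝ => 1 - α) (Icc 0 1) (Icc 0 1) :=
    fun x hx => ⟨by linarith [hx.2], by linarith [hx.1]⟩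
  -- reflection turns left derivatives into right derivatives
  have key := intervalIntegral.integral_eq_sub_of_hasDeriv_right_of_le (a := 0) (b := 1)
    (f := fun α => -h (1 - α)) (f' := fun α => leftDeriv h (1 - α)) zero_le_one
    (hc.comp (by fun_prop) hmaps).neg ?_ ?_
  · rw [intervalIntegral.integral_of_le zero_le_one, integral_Ioc_eq_integral_Ioo] at key
    simpa [hh.2.1, hh.2.2] using key
  · intro x hx
    have h1 := hasDerivWithinAt_leftDeriv hh (t := 1 - x)
      ⟨by linarith [hx.2], by linarith [hx.1]⟩
    have h2 : HasDerivWithinAt (fun α : ℝ => 1 - α) (-1) (Ioi x) x := by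
      simpa using (hasDerivWithinAt_id x (Ioi x)).const_sub 1
    have h3 := (h1.scomp x h2 (fun y hy => by simpa using hy)).neg
    rw [smul_eq_mul, neg_one_mul, neg_neg] at h3
    exact h3
  · rw [intervalIntegrable_iff_integrableOn_Ioo_of_le zero_le_one]
    exact hi

theorem toReal_eLpNorm_two_sq {α : Type*} [MeasurableSpace α] {μ : Measure α} {f : α → ℝ}
    (hf : MemLp f 2 μ) : (eLpNorm f 2 μ).toReal ^ 2 = ∫ x, f x ^ 2 ∂μ := by
  have h0 : 0 ≤ ∫ x, f x ^ 2 ∂μ := integral_nonneg fun x => sq_nonneg _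
  rw [hf.eLpNorm_eq_integral_rpow_norm two_ne_zero ENNReal.ofNat_ne_top]
  simp only [ENNReal.toReal_ofNat, Real.rpow_two, Real.norm_eq_abs, sq_abs]
  rw [ENNReal.toReal_ofReal (by positivity), ← Real.rpow_natCast, ← Real.rpow_mul h0]
  norm_num

/-- The facts about `h ∈ Φᵖ` on which the extremal problem rests: `α ↦ h' (1 - α)` is
square-integrable and centred, with standard deviation `‖h'‖₂`. -/
theorem Phi.leftDeriv_one_sub {p : ℝ≥0∞} (hp2 : p ≤ 2) {h : ℝ → ℝ}
    (hh : h ∈ Phi p) :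
    MemLp (fun α => leftDeriv h (1 - α)) 2 uniform01 ∧
      ∫ α, leftDeriv h (1 - α) ∂uniform01 = 0 ∧
      ∫ α, leftDeriv h (1 - α) ^ 2 ∂uniform01 = (derivNorm h 2).toReal ^ 2 := by
  obtain ⟨hh, hfin⟩ := hh
  have hc : ContinuousOn h (Icc 0 1) := by
    by_contra hc
    simp [derivNorm, hc] at hfin
  simp only [derivNorm, if_pos hc] at hfin ⊢
  have hm : AEStronglyMeasurable (leftDeriv h) uniform01 :=
    (aemeasurable_restrict_of_antitoneOn measurableSet_Ioo
      (DistortionFunctions.antitoneOn_leftDeriv hh)).aestronglyMeasurable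
  have hq : (2 : ℝ≥0∞) ≤ (1 - 1 / p)⁻¹ := by
    rw [ENNReal.le_inv_iff_le_inv, one_div]
    refine tsub_le_iff_right.2 ?_
    calc (1 : ℝ≥0∞) = 2⁻¹ + 2⁻¹ := ENNReal.inv_two_add_inv_two.symm
      _ ≤ 2⁻¹ + p⁻¹ := by gcongr
  have hL : MemLp (leftDeriv h) 2 uniform01 := MemLp.mono_exponent ⟨hm, hfin⟩ hq
  have hR : MemLp (fun α => leftDeriv h (1 - α)) 2 uniform01 :=
    hL.comp_measurePreserving measurePreserving_one_sub
  refine ⟨hR, DistortionFunctions.integral_leftDeriv_one_sub hh hc (hR.integrable one_le_two), ?_⟩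
  rw [← toReal_eLpNorm_two_sq hR, ← eLpNorm_comp_measurePreserving hm measurePreserving_one_sub]
  rfl

/-! ### The extremal problem for a single distortion function -/

/-- The Cauchy–Schwarz inequality for a covariance whose second factor is centred. -/
theorem integral_mul_le_of_variance {α : Type*} [MeasurableSpace α] {μ : Measure α}
    [IsProbabilityMeasure μ] {f k : α → ℝ} (hf : MemLp f 2 μ) (hk : MemLp k 2 μ)
    (hk0 : ∫ x, k x ∂μ = 0) {s t : ℝ} (hs : 0 ≤ s) (ht : 0 ≤ t) (hfs : Var[f; μ] = s ^ 2)
    (hkt : ∫ x, k x ^ 2 ∂μ = t ^ 2) : ∫ x, f x * k x ∂μ ≤ s * t := by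
  have hcov : ∫ x, f x * k x ∂μ = cov[f, k; μ] := by
    rw [covariance_eq_sub hf hk, hk0]; simp
  have hkv : Var[k; μ] = t ^ 2 := by rw [variance_of_integral_eq_zero hk.aemeasurable hk0, hkt]
  have hd : discrim (t ^ 2) (2 * cov[f, k; μ]) (s ^ 2) ≤ 0 := discrim_le_zero fun c => by
    have h0 := variance_nonneg (f + c • k) μ
    rw [variance_add hf (hk.const_smul c), covariance_smul_right, variance_smul, hfs, hkv] at h0
    linarith
  rw [discrim] at hd
  rw [hcov]
  exact (le_abs_self _).trans (abs_le_of_sq_le_sq' (by nlinarith) (by positivity) |> abs_le.2)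

theorem signedChoquet_le {p : ℝ≥0∞} (hp2 : p ≤ 2) {h : ℝ → ℝ} (hh : h ∈ Phi p)
    {m v : ℝ} (hv : 0 ≤ v) {X : Ω → ℝ} (hX : X ∈ L2MeanVar P m v) :
    signedChoquet P h X ≤ v * (derivNorm h 2).toReal := by
  obtain ⟨h1, h2, h3⟩ := Phi.leftDeriv_one_sub hp2 hh
  have hid := identDistrib_VaR hX.1.aemeasurable
  exact integral_mul_le_of_variance (hid.symm.memLp_snd hX.1) h1 h2 hv ENNReal.toReal_nonneg
    (hid.variance_eq.trans hX.2.2) h3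

/-- Every nondegenerate increasing square-integrable profile on `(0,1)` is, up to an affine change,
the quantile function of a random variable with prescribed mean and variance. -/
theorem IsNonatomic.exists_mem_L2MeanVar (hP : IsNonatomic P) {f : ℝ → ℝ}
    (hf : MonotoneOn f (Ioo 0 1)) (hf2 : MemLp f 2 uniform01) (hf0 : ∫ α, f α ∂uniform01 = 0)
    {t : ℝ} (ht : 0 < t) (hft : ∫ α, f α ^ 2 ∂uniform01 = t ^ 2) (m : ℝ) {v : ℝ} (hv : 0 ≤ v) :
    ∃ X ∈ L2MeanVar P m v, VaR P X =ᵐ[uniform01] fun α => m + v / t * f α := by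
  obtain ⟨U, hU, hlaw⟩ := hP.exists_uniform
  set k : ℝ → ℝ := fun α => m + v / t * f α with hk
  have hk2 : MemLp k 2 uniform01 := (memLp_const m).add (hf2.const_mul (v / t))
  have hkm : MonotoneOn k (Ioo 0 1) := fun a ha b hb hab => by
    have := hf ha hb hab
    simp only [hk]; gcongr
  obtain ⟨hid, hV⟩ := VaR_comp_ae_eq hU.aemeasurable hlaw hkm (hk2.integrable one_le_two)
  refine ⟨_, ⟨hid.symm.memLp_snd hk2, hid.integral_eq.trans ?_, hid.variance_eq.trans ?_⟩, hV⟩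
  · rw [integral_add (integrable_const _) ((hf2.integrable one_le_two).const_mul _),
      integral_const_mul, hf0]
    simp
  · rw [hk, variance_const_add (hf2.const_mul _).aestronglyMeasurable, variance_const_mul,
      variance_of_integral_eq_zero hf2.aemeasurable hf0, hft]
    field_simp

/-- Equality in the Cauchy–Schwarz bound `signedChoquet_le` is attained. -/
theorem IsNonatomic.exists_signedChoquet_eq (hP : IsNonatomic P) {p : ℝ≥0∞} (hp2 : p ≤ 2)
    {h : ℝ → ℝ} (hh : h ∈ Phi p) (m : ℝ) {v : ℝ} (hv : 0 ≤ v)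
    (hpos : 0 < (derivNorm h 2).toReal) :
    ∃ X ∈ L2MeanVar P m v, signedChoquet P h X = v * (derivNorm h 2).toReal := by
  obtain ⟨h1, h2, h3⟩ := Phi.leftDeriv_one_sub hp2 hh
  obtain ⟨X, hX, hV⟩ := hP.exists_mem_L2MeanVar
    (DistortionFunctions.monotoneOn_leftDeriv_one_sub hh.1) h1 h2 hpos h3 m hv
  refine ⟨X, hX, ?_⟩
  set t := (derivNorm h 2).toReal
  calc signedChoquet P h X
      = ∫ α, (m * leftDeriv h (1 - α) + v / t * leftDeriv h (1 - α) ^ 2) ∂uniform01 := by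
        refine integral_congr_ae ?_
        filter_upwards [hV] with α hα
        rw [hα]; ring
    _ = v * t := by
        rw [integral_add ((h1.integrable one_le_two).const_mul _) (h1.integrable_sq.const_mul _),
          integral_const_mul, integral_const_mul, h2, h3]
        field_simp
        simp

/-- The candidate is an affine image of a uniform variable, whose variance is `1 / 12`. -/
theorem IsNonatomic.L2MeanVar_nonempty (hP : IsNonatomic P) (m : ℝ) {v : ℝ} (hv : 0 ≤ v) :
    (L2MeanVar P m v).Nonempty := by
  have hm : MemLp (fun α : ℝ => α - 1 / 2) 2 uniform01 := by
    refine MemLp.of_bound (by fun_prop) 1 ?_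
    filter_upwards [ae_restrict_mem measurableSet_Ioo] with α hα
    rw [Real.norm_eq_abs, abs_le]
    constructor <;> linarith [hα.1, hα.2]
  have hint : ∀ f : ℝ → ℝ, ∫ α, f α ∂uniform01 = ∫ α in (0 : ℝ)..1, f α := fun f => by
    rw [intervalIntegral.integral_of_le zero_le_one, integral_Ioc_eq_integral_Ioo]
  have h1 : ∫ α, (α - 1 / 2) ∂uniform01 = 0 := by
    rw [hint, intervalIntegral.integral_sub (by simp) (by simp)]
    norm_num
  have h2 : ∫ α, (α - 1 / 2) ^ 2 ∂uniform01 = √(1 / 12) ^ 2 := by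
    rw [hint, intervalIntegral.integral_comp_sub_right (fun x => x ^ 2) (1 / 2), integral_pow,
      Real.sq_sqrt (by norm_num)]
    norm_num
  obtain ⟨X, hX, -⟩ := hP.exists_mem_L2MeanVar (fun a _ b _ hab => sub_le_sub_right hab _) hm h1
    (by positivity) h2 m hv
  exact ⟨X, hX⟩

end MeanDeviation

/-! ### The worst case over all distortion functions -/

open MeanDeviation in
theorem propositionS3 {Ω : Type*} [MeasurableSpace Ω] (P : Measure Ω) [IsProbabilityMeasure P]
    (hP : MeanDeviation.IsNonatomic P)
    (p : ℝ≥0∞) (hp1 : 1 ≤ p) (hp2 : p ≤ 2) (m v : ℝ) (hv : 0 < v)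
    (g : ℝ → ℝ) (hg : MeanDeviation.IsRiskWeighting g)
    (D : (Ω → ℝ) → ℝ) (hD : MeanDeviation.IsLawInvariantDeviation P p D)
    (Ψ : Set (ℝ → ℝ)) (hΨ : Ψ ⊆ MeanDeviation.Phi p)
    (hDΨ : MeanDeviation.IsSupOfChoquet P p Ψ D) :
    MeanDeviation.worstCaseMD P g D m v =
      (⨆ h ∈ Ψ, (g (v * (MeanDeviation.derivNorm h 2).toReal) : EReal)) + (m : EReal) := by
  have hLp : ∀ X ∈ L2MeanVar P m v, MemLp X p P := fun X hX => hX.1.mono_exponent hp2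
  have hMD : ∀ X ∈ L2MeanVar P m v, (MD P g D X : EReal) = (g (D X) : EReal) + (m : EReal) :=
    fun X hX => by rw [MD, hX.2.1, EReal.coe_add]
  apply le_antisymm
  · refine iSup₂_le fun X hX => ?_
    rw [hMD X hX]
    refine add_le_add_left ?_ _
    have hD0 := hD.nonneg X (hLp X hX)
    refine EReal.le_of_forall_lt_iff_le.1 fun z hz => ?_
    refine EReal.coe_le_coe_iff.2 (le_of_forall_pos_le_add fun ε hε => ?_)
    obtain ⟨_, ⟨h, hh, rfl⟩, hlt⟩ :=
      (lt_isLUB_iff (hDΨ X (hLp X hX))).1 (sub_lt_self (D X) hε)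
    have hle := signedChoquet_le hp2 (hΨ hh) hv.le hX
    have h0 : 0 ≤ v * (derivNorm h 2).toReal := mul_nonneg hv.le ENNReal.toReal_nonneg
    have hgz : g (v * (derivNorm h 2).toReal) ≤ z := EReal.coe_le_coe_iff.1
      ((le_iSup₂ (f := fun h (_ : h ∈ Ψ) => (g (v * (derivNorm h 2).toReal) : EReal)) h hh).trans
        hz.le)
    -- truncation at `0` keeps the comparison point in the domain of `g`
    have hw0 : 0 ≤ max (D X - ε) 0 := le_max_right _ _
    have hw := hg.mono hw0 h0 (max_le (hlt.le.trans hle) h0)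
    have hlip := hg.lipschitz (D X) hD0 _ hw0
    have hw1 : |D X - max (D X - ε) 0| ≤ ε := by
      rw [abs_le]
      constructor
      · rcases max_cases (D X - ε) 0 with ⟨h, _⟩ | ⟨h, _⟩ <;> rw [h] <;> linarith
      · linarith [le_max_left (D X - ε) 0]
    linarith [le_abs_self (g (D X) - g (max (D X - ε) 0))]
  · rw [← EReal.le_sub_iff_add_le (by simp) (by simp)]
    refine iSup₂_le fun h hh => ?_
    rw [EReal.le_sub_iff_add_le (by simp) (by simp)]
    -- a candidate whose deviation dominates `v ‖h'‖₂`; any candidate does if `‖h'‖₂ = 0`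
    obtain ⟨X, hX, hle⟩ : ∃ X ∈ L2MeanVar P m v, v * (derivNorm h 2).toReal ≤ D X := by
      rcases ENNReal.toReal_nonneg.eq_or_lt' with h0 | hpos
      · obtain ⟨X, hX⟩ := hP.L2MeanVar_nonempty m hv.le
        exact ⟨X, hX, by rw [h0, mul_zero]; exact hD.nonneg X (hLp X hX)⟩
      · obtain ⟨X, hX, hXh⟩ := hP.exists_signedChoquet_eq hp2 (hΨ hh) m hv.le hpos
        exact ⟨X, hX, hXh ▸ (hDΨ X (hLp X hX)).1 ⟨h, hh, rfl⟩⟩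
    have h0 : 0 ≤ v * (derivNorm h 2).toReal := mul_nonneg hv.le ENNReal.toReal_nonneg
    calc (g (v * (derivNorm h 2).toReal) : EReal) + (m : EReal) ≤ (g (D X) : EReal) + (m : EReal) :=
          add_le_add_left (EReal.coe_le_coe_iff.2 (hg.mono h0 (h0.trans hle) hle)) _
      _ = (MD P g D X : EReal) := (hMD X hX).symm
      _ ≤ _ := le_iSup₂ (f := fun X (_ : X ∈ L2MeanVar P m v) => (MD P g D X : EReal)) X hX
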